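/- Let $\mathbb K\in\{\mathbb R,\mathbb C\}$ and let $E$ be an F-sequence space over $\mathbb N=\{0,1,2,\dots\}$: a linear subspace of $\mathbb K^{\mathbb N}$ endowed with a complete metrizable vector space topology for which the inclusion $E\hookrightarrow\mathbb K^{\mathbb N}$ is continuous. Assume that $E$ is locally bounded or locally convex, that it contains the canonical unit sequences $e_n$, $n\ge 0$, and that $\operatorname{span}\{e_n\mid n\ge 0\}$ is dense in $E$. Let $T:E\to E$ be a weighted shift, that is, a continuous linear operator with $T(e_0)=0$ and $T(e_n)=w_ne_{n-1}$ for $n\ge 1$, where the weights $w_n\in\mathbb K$ are nonzero, and let $P(z)=\sum_{k=1}^d a_kz^k$ be a polynomial over $\mathbb K$ with $a_1\neq 0$. Then there are vectors $u_n\in\operatorname{span}\{e_0,\dots,e_n\}$, $n\ge 0$, such that $(u_n)_{n\ge 0}$ is an algebraic basis of $\operatorname{span}\{e_n\mid n\ge 0\}$ and $P(T)u_n=u_{n-1}$ for every $n\ge 1$. Moreover, let $(u_n)_{n\ge0}$ be any such sequence, and assume that the series $\sum_{n\ge 0}u_n$ is unconditionally convergent in $E$. Then there exists a $\mathbb K$-valued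 random variable $X$ with full support (that is, $\mathbb P(X\in O)>0$ for every nonempty open $O\subseteq\mathbb K$) such that, whenever $(X_n)_{n\ge 0}$ is a sequence of i.i.d. copies of $X$, the following hold for $$v:=\sum_{n=0}^\infty X_nu_n .$$ 1. The series defining $v$ almost surely converges unconditionally in $E$, and $v$ is a random vector in $E$. 2. Almost surely, $v$ is frequently hypercyclic for $P(T)$: for every nonempty open set $O\subseteq E$, the set $\{n\ge 0\mid P(T)^nv\in O\}$ has positive lower density, where the lower density of $A\subseteq\mathbb N$ is $\liminf_{N\to\infty}\frac{1}{N+1}\,\#(A\cap\{0,\dots,N\})$. 3. The law $\mu$ of $v$ is an exact measure for $P(T)$: it is a $P(T)$-invariant Borel probability measure on $E$, and every set in $\bigcap_{n\ge 0}P(T)^{-n}(\mathcal B(E))$ has $\mu$-measure $0$ or $1$. Here $\mathcal B(E)$ is the Borel $\sigma$-algebra of $E$. 4. The measure $\mu$ has full support: $\mu(O)>0$ for every nonempty open set $O\subseteq E$. -/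

import Mathlib

open MeasureTheory ProbabilityTheory Filter Topology Uniformity

/-- A vector space `E` with a vector topology, realised as a sequence space over `ℕ` that contains the
canonical unit sequences: `coord` identifies `E` with a linear subspace of `𝕜^ℕ`, and its continuity
says that convergence in `E` implies coordinatewise convergence. -/
structure SequenceSpace (𝕜 E : Type*) [RCLike 𝕜] [AddCommGroup E] [Module 𝕜 E]
    [TopologicalSpace E] where
  /-- the inclusion of `E` into the space of all scalar sequences -/
  coord : E →L[𝕜] (ℕ → 𝕜)
  coord_injective : Function.Injective coord
  /-- the canonical unit sequences `(0, …, 0, 1, 0, …)`, as elements of `E` -/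
  e : ℕ → E
  coord_e : ∀ n, coord (e n) = Pi.single n 1

/-- A topological vector space is locally bounded if `0` has a (von Neumann) bounded neighbourhood. -/
def IsLocallyBounded (𝕜 E : Type*) [RCLike 𝕜] [AddCommGroup E] [Module 𝕜 E]
    [TopologicalSpace E] : Prop :=
  ∃ U ∈ 𝓝 (0 : E), Bornology.IsVonNBounded 𝕜 U

/-- `T` is the (unilateral) weighted shift with weights `w 1, w 2, …`; the value `w 0` plays no role. -/
structure IsWeightedShift {𝕜 E : Type*} [RCLike 𝕜] [AddCommGroup E] [Module 𝕜 E]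
    [TopologicalSpace E] (S : SequenceSpace 𝕜 E) (T : E →L[𝕜] E) (w : ℕ → 𝕜) : Prop where
  weight_ne_zero : ∀ n, w (n + 1) ≠ 0
  map_zero : T (S.e 0) = 0
  map_succ : ∀ n, T (S.e (n + 1)) = w (n + 1) • S.e n

/-- `u` is a triangular algebraic basis of the space of finite sequences along which the operator `A`
acts as the backward shift. -/
structure IsShiftBasis {𝕜 E : Type*} [RCLike 𝕜] [AddCommGroup E] [Module 𝕜 E]
    [TopologicalSpace E] (S : SequenceSpace 𝕜 E) (A : E →L[𝕜] E) (u : ℕ → E) : Prop where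
  triangular : ∀ n, ∃ b : ℕ → 𝕜, u n = ∑ j ∈ Finset.range (n + 1), b j • S.e j
  linearIndependent : LinearIndependent 𝕜 u
  span_eq : Submodule.span 𝕜 (Set.range u) = Submodule.span 𝕜 (Set.range S.e)
  map_succ : ∀ n, A (u (n + 1)) = u n

open Classical in
/-- The lower density `liminf_N #{n ≤ N : n ∈ A} / (N + 1)` of a set of natural numbers. -/
noncomputable def lowerDensity (A : Set ℕ) : ℝ :=
  liminf (fun N : ℕ => (((Finset.range (N + 1)).filter (fun n => n ∈ A)).card : ℝ) / ((N : ℝ) + 1))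
    atTop

/-- `x` is frequently hypercyclic for `A`: its orbit visits every nonempty open set along a set of
times of positive lower density. -/
def IsFrequentlyHypercyclic {E : Type*} [TopologicalSpace E] (A : E → E) (x : E) : Prop :=
  ∀ O : Set E, IsOpen O → O.Nonempty → 0 < lowerDensity {n : ℕ | A^[n] x ∈ O}

/-- `μ` is an exact measure for `A`: an `A`-invariant probability measure for which every set in
`⋂ n, A⁻ⁿ(𝓑)`, where `𝓑` is the given `σ`-algebra, has measure `0` or `1`. -/
structure IsExactMeasure {E : Type*} [m : MeasurableSpace E] (A : E → E) (μ : Measure E) :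
    Prop where
  isProbabilityMeasure : IsProbabilityMeasure μ
  measurePreserving : MeasurePreserving A μ μ
  exact : ∀ B : Set E, MeasurableSet[⨅ n : ℕ, MeasurableSpace.comap (A^[n]) m] B →
    μ B = 0 ∨ μ B = 1

/-! Along a shift basis, `P(T)` sends `∑ xₙuₙ` to `∑ xₙ₊₁uₙ`. So the law of `v = ∑ Xₙuₙ` is a factor
of the one-sided Bernoulli shift, and the dynamics come from there: invariance from the i.i.d.
property, exactness from Kolmogorov's zero-one law (`infinitePi_eq_zero_or_one_of_ae_eq_shift`),
full support from density of the span and independence of head and tail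
(`isOpenPosMeasure_map_tsum_smul`). Frequent hypercyclicity follows from exactness and full support;
instead of the pointwise ergodic theorem, a block-counting argument shows that a set visited with
lower density zero by almost every orbit is null (`measure_eq_zero_of_ae_lowerDensity_nonpos`).

The analytic difficulty is convergence, since `X` must be unbounded. Local boundedness or local
convexity enters only here: it allows bounded multipliers in `∑ uₙ`, and then multipliers bounded by
some `Mₙ → ∞` (`Summable.exists_tendsto_atTop_summable_smul`). A law of full support with `∑ ℙ(‖X‖ >
Mₙ) < ∞` exists, and Borel–Cantelli gives almost sure unconditional convergence.

The basis exists because `P(T)eₙ₊₁` is a nonzero multiple of `eₙ` plus lower terms, so preimages can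
be chosen one degree higher. -/

/-! ### Multipliers of unconditionally convergent series -/

section BoundedMultipliers

open scoped Pointwise

variable {𝕜 E : Type*} [RCLike 𝕜] [AddCommGroup E] [Module 𝕜 E]

/-- The common substitute for convexity in both cases: for a bounded neighbourhood `U`, the bounded
set `U + U` is absorbed by some `bU`, and a rescaled `U` serves as `C`; in a convex neighbourhood
midpoints give `b = 2`. -/
lemma exists_nhds_inv_smul_add_mem [Module ℝ E] [IsScalarTower ℝ 𝕜 E] [TopologicalSpace E]
    [IsTopologicalAddGroup E] [ContinuousSMul 𝕜 E]
    (hE : IsLocallyBounded 𝕜 E ∨ LocallyConvexSpace ℝ E) {V : Set E} (hV : V ∈ 𝓝 0) :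
    ∃ b : ℕ, 2 ≤ b ∧ ∃ C ∈ 𝓝 (0 : E), C ⊆ V ∧
      ∀ x ∈ C, ∀ y ∈ C, ((b : 𝕜)⁻¹) • (x + y) ∈ C := by
  rcases hE with ⟨U, hU, hUb⟩ | hE
  · have hcast : Tendsto (fun n : ℕ => (n : 𝕜)) atTop (Bornology.cobounded 𝕜) :=
      tendsto_norm_atTop_iff_cobounded.1 (by
        simpa using tendsto_natCast_atTop_atTop (R := ℝ))
    have h1 : ∀ᶠ n : ℕ in atTop, U + U ⊆ (n : 𝕜) • U := hcast.eventually ((hUb.add hUb) hU)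
    have h2 : ∀ᶠ n : ℕ in atTop, U ⊆ (n : 𝕜) • V := hcast.eventually (hUb hV)
    obtain ⟨b, hb, hb2⟩ := (h1.and (eventually_ge_atTop 2)).exists
    obtain ⟨s, hs, hs2⟩ := (h2.and (eventually_ge_atTop 1)).exists
    have hs0 : (s : 𝕜) ≠ 0 := by
      have : s ≠ 0 := by omega
      exact_mod_cast this
    have hb0 : (b : 𝕜) ≠ 0 := by
      have : b ≠ 0 := by omega
      exact_mod_cast this
    refine ⟨b, hb2, (s : 𝕜)⁻¹ • U, ?_, ?_, ?_⟩
    · have := smul_mem_nhds_smul₀ (inv_ne_zero hs0) hU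
      simpa using this
    · rintro _ ⟨x, hx, rfl⟩
      obtain ⟨v, hv, rfl⟩ := hs hx
      simpa [smul_smul, hs0] using hv
    · rintro _ ⟨x, hx, rfl⟩ _ ⟨y, hy, rfl⟩
      obtain ⟨z, hz, hxy⟩ := hb (Set.add_mem_add hx hy)
      refine ⟨z, hz, ?_⟩
      simp only at hxy ⊢
      rw [← smul_add, ← hxy, smul_comm (b : 𝕜)⁻¹, smul_smul (b : 𝕜)⁻¹, inv_mul_cancel₀ hb0, one_smul]
  · obtain ⟨C, hC, hconv, hCV⟩ :=
      (locallyConvexSpace_iff_exists_convex_subset_zero ℝ E).1 hE V hV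
    refine ⟨2, le_rfl, C, hC, hCV, fun x hx y hy => ?_⟩
    have := hconv hx hy (a := 1 / 2) (b := 1 / 2) (by norm_num) (by norm_num) (by norm_num)
    convert this using 1
    rw [← smul_add, ← algebraMap_smul 𝕜 (1 / 2 : ℝ), map_div₀, map_one, map_ofNat, one_div,
      Nat.cast_ofNat]

lemma exists_nhds_sum_range_mem [TopologicalSpace E] [IsTopologicalAddGroup E] (b : ℕ)
    {V : Set E} (hV : V ∈ 𝓝 0) :
    ∃ W ∈ 𝓝 (0 : E), ∀ x : ℕ → E, (∀ j, x j ∈ W) → ∑ j ∈ Finset.range b, x j ∈ V := by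
  induction b generalizing V with
  | zero => exact ⟨Set.univ, univ_mem, fun x _ => by simpa using mem_of_mem_nhds hV⟩
  | succ b ih =>
    obtain ⟨V', hV', hadd⟩ := exists_nhds_zero_half hV
    obtain ⟨W, hW, h⟩ := ih hV'
    refine ⟨W ∩ V', inter_mem hW hV', fun x hx => ?_⟩
    rw [Finset.sum_range_succ]
    exact hadd _ (h x fun j => (hx j).1) _ (hx b).2

lemma sum_range_mem_of_add_subset {V : ℕ → Set E}
    (hV : ∀ n, V (n + 1) + V (n + 1) ⊆ V n) (h0 : ∀ n, 0 ∈ V n) {x : ℕ → E} (hx : ∀ n, x n ∈ V n) (m k : ℕ) :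
    ∑ i ∈ Finset.range m, x (k + 1 + i) ∈ V k := by
  induction m generalizing k with
  | zero => simpa using h0 k
  | succ m ih =>
    rw [Finset.sum_range_succ']
    refine hV k (Set.add_mem_add ?_ (hx (k + 1 + 0)))
    convert ih (k + 1) using 3
    ring_nf

variable [UniformSpace E] [IsUniformAddGroup E]

lemma Summable.exists_nat_sum_mem {u : ℕ → E} (hu : Summable u) [CompleteSpace E] {V : Set E}
    (hV : V ∈ 𝓝 0) :
    ∃ N : ℕ, ∀ G : Finset ℕ, (∀ n ∈ G, N ≤ n) → ∑ n ∈ G, u n ∈ V := by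
  obtain ⟨s, hs⟩ := summable_iff_vanishing.1 hu V hV
  refine ⟨s.sup id + 1, fun G hG => hs G ?_⟩
  rw [Finset.disjoint_left]
  intro n hn hns
  have h1 := hG n hn
  have h2 : n ≤ s.sup id := Finset.le_sup (f := id) hns
  omega

variable [Module ℝ E] [IsScalarTower ℝ 𝕜 E] [ContinuousSMul 𝕜 E]

/-- Expand the coefficients in base `b`. A sum with digit coefficients splits into `b` subsums of
the series, and the stability of `C` under `(x, y) ↦ b⁻¹(x + y)` absorbs any number of digits, so
`N` depends neither on the precision nor on `G`. -/
lemma Summable.exists_nat_sum_unitInterval_smul_mem [CompleteSpace E]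
    (hE : IsLocallyBounded 𝕜 E ∨ LocallyConvexSpace ℝ E)
    {u : ℕ → E} (hu : Summable u) {V : Set E} (hV : V ∈ 𝓝 0) :
    ∃ N : ℕ, ∀ G : Finset ℕ, (∀ n ∈ G, N ≤ n) → ∀ c : ℕ → ℝ, (∀ n, 0 ≤ c n ∧ c n ≤ 1) →
      ∑ n ∈ G, (c n : 𝕜) • u n ∈ V := by
  obtain ⟨V', hV', hadd⟩ := exists_nhds_zero_half hV
  obtain ⟨b, hb, C, hC, hCV, hCb⟩ := exists_nhds_inv_smul_add_mem (𝕜 := 𝕜) hE hV'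
  obtain ⟨W, hW, hWb⟩ := exists_nhds_sum_range_mem b hC
  obtain ⟨N, hN⟩ := hu.exists_nat_sum_mem hW
  have hb0 : (0 : ℝ) < b := by exact_mod_cast (by omega : 0 < b)
  have hbk : (b : 𝕜) ≠ 0 := by exact_mod_cast (by omega : b ≠ 0)
  refine ⟨N, fun G hG c hc => ?_⟩
  -- The digit `b` itself is allowed, because a coefficient may equal `1`.
  have digits : ∀ d : ℕ → ℕ, (∀ n, d n ≤ b) → ∑ n ∈ G, (d n : 𝕜) • u n ∈ C := by
    intro d hd
    have : ∑ n ∈ G, (d n : 𝕜) • u n =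
        ∑ j ∈ Finset.range b, ∑ n ∈ G.filter (fun n => j < d n), u n := by
      simp_rw [Finset.sum_filter]
      rw [Finset.sum_comm]
      refine Finset.sum_congr rfl fun n _ => ?_
      rw [← Finset.sum_filter, Finset.sum_const]
      have : (Finset.range b).filter (fun j => j < d n) = Finset.range (d n) := by
        ext j
        have := hd n
        simp only [Finset.mem_filter, Finset.mem_range]
        omega
      rw [this, Finset.card_range, Nat.cast_smul_eq_nsmul]
    rw [this]
    exact hWb _ fun j => hN _ fun n hn => hG n (Finset.mem_filter.1 hn).1
  have expand : ∀ K : ℕ, ∀ c : ℕ → ℝ, (∀ n, 0 ≤ c n ∧ c n ≤ 1) →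
      ∃ c' : ℕ → ℝ, (∀ n, 0 ≤ c' n ∧ c' n ≤ 1) ∧ ∃ y ∈ C,
        ∑ n ∈ G, (c n : 𝕜) • u n = y + ((b : 𝕜)⁻¹) ^ K • ∑ n ∈ G, (c' n : 𝕜) • u n := by
    intro K
    induction K with
    | zero => exact fun c hc => ⟨c, hc, 0, mem_of_mem_nhds hC, by simp⟩
    | succ K ih =>
      intro c hc
      obtain ⟨c', hc', y, hy, h⟩ := ih (fun n => b * c n - ⌊b * c n⌋₊) (fun n => by
        have h0 : 0 ≤ b * c n := mul_nonneg hb0.le (hc n).1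
        have := Nat.floor_le h0
        have := Nat.lt_floor_add_one (b * c n)
        constructor <;> linarith)
      refine ⟨c', hc', (b : 𝕜)⁻¹ • (∑ n ∈ G, ((⌊b * c n⌋₊ : ℕ) : 𝕜) • u n + y),
        hCb _ (digits _ fun n => ?_) _ hy, ?_⟩
      · refine Nat.floor_le_of_le ?_
        have := (hc n).2
        nlinarith
      · rw [pow_succ', ← smul_smul, ← smul_add, add_assoc, ← h, ← Finset.sum_add_distrib,
          Finset.smul_sum]
        refine Finset.sum_congr rfl fun n _ => ?_
        rw [← add_smul, smul_smul]
        congr 1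
        push_cast
        field_simp
        ring
  choose c' hc' y hy h using fun K => expand K c hc
  have hlim : Tendsto (fun K => ((b : 𝕜)⁻¹) ^ K • ∑ n ∈ G, (c' K n : 𝕜) • u n) atTop (𝓝 0) := by
    simp_rw [Finset.smul_sum, smul_smul]
    rw [show (0 : E) = ∑ n ∈ G, (0 : 𝕜) • u n by simp]
    refine tendsto_finsetSum _ fun n _ => Tendsto.smul_const ?_ _
    have hb1 : ‖(b : 𝕜)⁻¹‖ < 1 := by
      rw [norm_inv, RCLike.norm_natCast]
      exact inv_lt_one_of_one_lt₀ (by exact_mod_cast (by omega : 1 < b))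
    refine squeeze_zero_norm (fun K => ?_) (tendsto_pow_atTop_nhds_zero_of_norm_lt_one
      (show ‖‖(b : 𝕜)⁻¹‖‖ < 1 by simpa using hb1))
    rw [norm_mul, norm_pow, RCLike.norm_ofReal, abs_of_nonneg (hc' K n).1]
    exact mul_le_of_le_one_right (by positivity) (hc' K n).2
  obtain ⟨K, hK⟩ := (hlim.eventually hV').exists
  rw [h K]
  exact hadd _ (hCV (hy K)) _ hK

/-- Positive and negative parts of the real and imaginary parts reduce this to four sums with
coefficients in `[0, 1]`; a balanced neighbourhood absorbs the signs and `I`. -/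
lemma Summable.exists_nat_sum_smul_mem [CompleteSpace E]
    (hE : IsLocallyBounded 𝕜 E ∨ LocallyConvexSpace ℝ E)
    {u : ℕ → E} (hu : Summable u) {V : Set E} (hV : V ∈ 𝓝 0) :
    ∃ N : ℕ, ∀ G : Finset ℕ, (∀ n ∈ G, N ≤ n) → ∀ c : ℕ → 𝕜, (∀ n, ‖c n‖ ≤ 1) →
      ∑ n ∈ G, c n • u n ∈ V := by
  obtain ⟨V₁, hV₁, hadd₁⟩ := exists_nhds_zero_half hV
  obtain ⟨V₂, hV₂, hadd₂⟩ := exists_nhds_zero_half hV₁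
  obtain ⟨B, ⟨hB, hBal⟩, hBV⟩ := (nhds_basis_balanced 𝕜 E).mem_iff.1 hV₂
  obtain ⟨N, hN⟩ := hu.exists_nat_sum_unitInterval_smul_mem hE hB
  refine ⟨N, fun G hG c hc => ?_⟩
  have hI : ‖(RCLike.I : 𝕜)‖ ≤ 1 := by
    by_cases h : (RCLike.I : 𝕜) = 0
    · simp [h]
    · exact (RCLike.norm_I_of_ne_zero h).le
  have part : ∀ (z : 𝕜) (r : ℕ → ℝ), ‖z‖ ≤ 1 → (∀ n, |r n| ≤ 1) →
      ∑ n ∈ G, (z * (max (r n) 0 : ℝ)) • u n ∈ V₂ := by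
    intro z r hz hr
    simp_rw [← smul_smul, ← Finset.smul_sum]
    exact hBV (hBal.smul_mem hz (hN G hG _ fun n =>
      ⟨le_max_right _ _, max_le ((le_abs_self _).trans (hr n)) zero_le_one⟩))
  have hre : ∀ n, |RCLike.re (c n)| ≤ 1 := fun n => (RCLike.abs_re_le_norm _).trans (hc n)
  have him : ∀ n, |RCLike.im (c n)| ≤ 1 := fun n => (RCLike.abs_im_le_norm _).trans (hc n)
  have hsplit : ∀ r : ℝ, (r : 𝕜) = (max r 0 : ℝ) - (max (-r) 0 : ℝ) := by
    intro r
    rw [← RCLike.ofReal_sub]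
    congr 1
    rcases le_total r 0 with h | h <;> simp [h]
  have key := hadd₁ _ (hadd₂ _ (part 1 _ (by simp) hre) _
    (part (-1) (fun n => -RCLike.re (c n)) (by simp) (by simpa using hre))) _
    (hadd₂ _ (part RCLike.I _ hI him) _
    (part (-RCLike.I) (fun n => -RCLike.im (c n)) (by simpa using hI) (by simpa using him)))
  convert key using 1
  rw [← Finset.sum_add_distrib, ← Finset.sum_add_distrib, ← Finset.sum_add_distrib]
  refine Finset.sum_congr rfl fun n _ => ?_
  rw [← add_smul, ← add_smul, ← add_smul]
  congr 1
  conv_lhs => rw [← RCLike.re_add_im (c n), hsplit (RCLike.re (c n)), hsplit (RCLike.im (c n))]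
  ring

/-- An unconditionally convergent series stays so after multiplication by any scalars that grow
slowly enough. -/
lemma Summable.exists_tendsto_atTop_summable_smul [CompleteSpace E] [IsCountablyGenerated (𝓤 E)]
    (hE : IsLocallyBounded 𝕜 E ∨ LocallyConvexSpace ℝ E) {u : ℕ → E} (hu : Summable u) :
    ∃ M : ℕ → ℕ, Tendsto M atTop atTop ∧
      ∀ c : ℕ → 𝕜, (∀ n, ‖c n‖ ≤ M n) → Summable fun n => c n • u n := by
  obtain ⟨V, hV, hVadd⟩ := IsTopologicalAddGroup.exists_antitone_basis_nhds_zero E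
  have hVmem : ∀ n, V n ∈ 𝓝 (0 : E) := fun n => hV.mem n
  choose N hN using fun j => hu.exists_nat_sum_smul_mem (𝕜 := 𝕜) hE (hVmem j)
  -- The bound `M n` counts the `j < n` with `N j ≤ n`. The multiplied series thus becomes a
  -- superposition of tails with bounded multipliers, the `j`-th having partial sums in `V j`.
  let χ : ℕ → ℕ → ℕ := fun n j => if N j ≤ n then 1 else 0
  have hχ1 : ∀ n j, χ n j ≤ 1 := fun n j => by
    simp only [χ]; split_ifs <;> simp
  refine ⟨fun n => ∑ j ∈ Finset.range n, χ n j, ?_, fun c hc => ?_⟩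
  · refine tendsto_atTop.2 fun J => ?_
    filter_upwards [eventually_ge_atTop ((Finset.range J).sup N), eventually_ge_atTop J]
      with n hn hJ
    calc J = ∑ j ∈ Finset.range J, χ n j := by
          rw [Finset.sum_congr rfl (g := fun _ => 1)]
          · simp
          · intro j hj
            simp [χ, (Finset.le_sup hj).trans hn]
      _ ≤ ∑ j ∈ Finset.range n, χ n j :=
        Finset.sum_le_sum_of_subset (Finset.range_mono hJ)
  set M : ℕ → ℕ := fun n => ∑ j ∈ Finset.range n, χ n j
  -- If `M n = 0` then `c n = 0`, so division by zero is harmless.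
  let t : ℕ → 𝕜 := fun n => c n / M n
  have ht : ∀ n, ‖t n‖ ≤ 1 := fun n => by
    rw [norm_div, RCLike.norm_natCast]
    exact div_le_one_of_le₀ (hc n) (by positivity)
  have hct : ∀ n, c n = ∑ j ∈ Finset.range n, (χ n j : 𝕜) * t n := fun n => by
    rw [← Finset.sum_mul, ← Nat.cast_sum]
    by_cases h : (M n : 𝕜) = 0
    · have h0 := hc n
      have : M n = 0 := by exact_mod_cast h
      rw [this] at h0
      have : c n = 0 := by simpa using h0
      simp [t, this]
    · exact (mul_div_cancel₀ _ h).symm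
  rw [summable_iff_vanishing]
  intro U hU
  obtain ⟨k, -, hk⟩ := hV.1.mem_iff.1 hU
  -- The tails with `j < k + 2` have a total multiplier of norm at most `k + 2`, so they are treated
  -- together; the others fit into `V (k + 1)` by halving.
  obtain ⟨N', hN'⟩ := hu.exists_nat_sum_smul_mem (𝕜 := 𝕜) hE
    (show (fun x : E => ((k + 2 : ℕ) : 𝕜) • x) ⁻¹' V (k + 1) ∈ 𝓝 0 from
      (continuous_const_smul _).continuousAt.preimage_mem_nhds (by simpa using hVmem (k + 1)))
  refine ⟨Finset.range (N' + k + 2), fun G hG => hk ?_⟩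
  have hG' : ∀ n ∈ G, N' + k + 2 ≤ n := fun n hn => by
    have := Finset.disjoint_left.1 hG hn
    simpa using this
  obtain ⟨m, hm⟩ : ∃ m, ∀ n ∈ G, n ≤ k + 2 + m :=
    ⟨G.sup id, fun n hn => (Finset.le_sup (f := id) hn).trans (by simp)⟩
  -- The cutoff `j < n` moves into the summand, so that the range of `j` is independent of `n` and
  -- the sums can be interchanged.
  have hct' : ∀ n ∈ G, c n = (∑ j ∈ Finset.range (k + 2), (χ n j : 𝕜)) * t n +
      ∑ i ∈ Finset.range m, (χ n (k + 1 + 1 + i) : 𝕜) * (if k + 2 + i < n then t n else 0) := by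
    intro n hn
    have h1 := hG' n hn
    have h2 := hm n hn
    rw [hct n]
    obtain ⟨l, rfl⟩ : ∃ l, n = k + 2 + l := ⟨n - (k + 2), by omega⟩
    rw [Finset.sum_range_add, Finset.sum_mul]
    congr 1
    simp only [add_lt_add_iff_left, mul_ite, mul_zero]
    rw [← Finset.sum_filter]
    refine Finset.sum_congr ?_ fun _ _ => rfl
    ext i
    simp only [Finset.mem_range, Finset.mem_filter]
    omega
  have hlow : ∑ n ∈ G, ((∑ j ∈ Finset.range (k + 2), (χ n j : 𝕜)) * t n) • u n ∈ V (k + 1) := by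
    have := hN' G (fun n hn => by have := hG' n hn; omega)
      (fun n => ((∑ j ∈ Finset.range (k + 2), (χ n j : 𝕜)) * t n) / ((k + 2 : ℕ) : 𝕜)) (fun n => by
        rw [norm_div, norm_mul, RCLike.norm_natCast, ← Nat.cast_sum, RCLike.norm_natCast]
        refine div_le_one_of_le₀ ((mul_le_of_le_one_right (by positivity) (ht n)).trans ?_)
          (by positivity)
        exact_mod_cast (Finset.sum_le_sum fun j _ => hχ1 n j).trans (by simp))
    rw [Set.mem_preimage, Finset.smul_sum] at this
    convert this using 2 with n
    rw [smul_smul, mul_div_cancel₀]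
    exact_mod_cast (by omega : k + 2 ≠ 0)
  have hhigh : ∑ i ∈ Finset.range m, ∑ n ∈ G,
      ((χ n (k + 1 + 1 + i) : 𝕜) * (if k + 2 + i < n then t n else 0)) • u n ∈ V (k + 1) := by
    refine sum_range_mem_of_add_subset hVadd (fun n => mem_of_mem_nhds (hVmem n))
      (x := fun j => ∑ n ∈ G, ((χ n j : 𝕜) * (if j < n then t n else 0)) • u n) (fun j => ?_)
      m (k + 1)
    have := hN j (G.filter fun n => N j ≤ n) (fun n hn => (Finset.mem_filter.1 hn).2)
      (fun n => if j < n then t n else 0) (fun n => by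
        split_ifs
        · exact ht n
        · simp)
    convert this using 1
    rw [Finset.sum_filter]
    refine Finset.sum_congr rfl fun n _ => ?_
    by_cases h : N j ≤ n <;> simp [χ, h]
  have := hVadd k (Set.add_mem_add hlow hhigh)
  convert this using 1
  rw [Finset.sum_comm, ← Finset.sum_add_distrib]
  refine Finset.sum_congr rfl fun n hn => ?_
  conv_lhs => rw [hct' n hn]
  rw [add_smul, Finset.sum_smul]

end BoundedMultipliers

/-! ### Construction of the shift basis -/

section ShiftBasis

variable {𝕜 E : Type*} [RCLike 𝕜] [AddCommGroup E] [Module 𝕜 E]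

lemma Polynomial.aeval_apply_mem_of_forall_mem [TopologicalSpace E] [IsTopologicalAddGroup E]
    [ContinuousConstSMul 𝕜 E] {T : E →L[𝕜] E} {F : Submodule 𝕜 E} (hT : ∀ x ∈ F, T x ∈ F)
    (P : Polynomial 𝕜) {x : E} (hx : x ∈ F) : Polynomial.aeval T P x ∈ F := by
  have hpow : ∀ k : ℕ, (T ^ k) x ∈ F := by
    intro k
    induction k with
    | zero => simpa using hx
    | succ k ih =>
      rw [pow_succ']
      exact hT _ ih
  rw [Polynomial.aeval_eq_sum_range, sum_apply]
  exact F.sum_mem fun k _ => F.smul_mem _ (hpow k)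

/-- Applying `A` to a relation gives a shorter one, which kills all coefficients but that of `u 0`.
-/
lemma linearIndependent_of_backward_shift {A : E →ₗ[𝕜] E} {u : ℕ → E} (h0 : A (u 0) = 0)
    (hu0 : u 0 ≠ 0) (hA : ∀ n, A (u (n + 1)) = u n) : LinearIndependent 𝕜 u := by
  have key : ∀ (N : ℕ) (g : ℕ → 𝕜), ∑ i ∈ Finset.range N, g i • u i = 0 → ∀ i < N, g i = 0 := by
    intro N
    induction N with
    | zero => intro g _ i hi; omega
    | succ N ih =>
      intro g hg
      rw [Finset.sum_range_succ'] at hg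
      have h1 := congrArg A hg
      simp only [map_add, map_sum, map_smul, hA, h0, smul_zero, add_zero, map_zero] at h1
      have h2 := ih (fun i => g (i + 1)) h1
      have h3 : ∑ i ∈ Finset.range N, g (i + 1) • u (i + 1) = 0 :=
        Finset.sum_eq_zero fun i hi => by
          rw [h2 i (Finset.mem_range.1 hi), zero_smul]
      rw [h3, zero_add, smul_eq_zero, or_iff_left hu0] at hg
      intro i hi
      cases i with
      | zero => exact hg
      | succ i => exact h2 i (by omega)
  rw [linearIndependent_iff']
  intro s g hg i hi
  have := key (s.sup id + 1) (fun i => if i ∈ s then g i else 0) (by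
    rw [← hg]
    simp only [ite_smul, zero_smul]
    rw [← Finset.sum_filter]
    refine Finset.sum_congr ?_ fun _ _ => rfl
    ext j
    simp only [Finset.mem_filter, Finset.mem_range, and_iff_right_iff_imp]
    intro hj
    have : j ≤ s.sup id := Finset.le_sup (f := id) hj
    omega) i (by
    have : i ≤ s.sup id := Finset.le_sup (f := id) hi
    omega)
  simpa [hi] using this

variable [TopologicalSpace E] {S : SequenceSpace 𝕜 E} {T : E →L[𝕜] E} {w : ℕ → 𝕜}

/-- The span of the first `n` unit sequences. -/
def SequenceSpace.initialSpan (S : SequenceSpace 𝕜 E) (n : ℕ) : Submodule 𝕜 E :=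
  Submodule.span 𝕜 (S.e '' (Finset.range n : Set ℕ))

lemma SequenceSpace.e_ne_zero (S : SequenceSpace 𝕜 E) (n : ℕ) : S.e n ≠ 0 := by
  intro h
  have := congrFun (S.coord_e n) n
  simp [h] at this

lemma SequenceSpace.e_mem_initialSpan (S : SequenceSpace 𝕜 E) {i n : ℕ} (h : i < n) :
    S.e i ∈ S.initialSpan n :=
  Submodule.subset_span ⟨i, by simpa using h, rfl⟩

lemma SequenceSpace.initialSpan_mono (S : SequenceSpace 𝕜 E) : Monotone S.initialSpan :=
  fun _ _ h => Submodule.span_mono (Set.image_mono (by simpa using h))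

lemma IsWeightedShift.map_e_mem (hT : IsWeightedShift S T w) (n : ℕ) :
    T (S.e n) ∈ S.initialSpan n := by
  cases n with
  | zero => rw [hT.map_zero]; exact zero_mem _
  | succ n =>
    rw [hT.map_succ]
    exact Submodule.smul_mem _ _ (S.e_mem_initialSpan n.lt_succ_self)

lemma IsWeightedShift.map_initialSpan (hT : IsWeightedShift S T w) (n : ℕ) :
    ∀ x ∈ S.initialSpan n, T x ∈ S.initialSpan n := by
  intro x hx
  induction hx using Submodule.span_induction with
  | mem x hx =>
    obtain ⟨i, hi, rfl⟩ := hx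
    exact S.initialSpan_mono (by simpa using (Finset.mem_range.1 hi).le) (hT.map_e_mem i)
  | zero => rw [_root_.map_zero]; exact zero_mem _
  | add x y _ _ hx hy => rw [map_add]; exact add_mem hx hy
  | smul c x _ hx => rw [map_smul]; exact Submodule.smul_mem _ _ hx

lemma SequenceSpace.exists_sum_of_mem_initialSpan (S : SequenceSpace 𝕜 E) {n : ℕ} {x : E}
    (hx : x ∈ S.initialSpan n) : ∃ b : ℕ → 𝕜, x = ∑ j ∈ Finset.range n, b j • S.e j := by
  obtain ⟨b, hb⟩ := (Submodule.mem_span_image_finset_iff_exists_fun 𝕜).1 hx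
  refine ⟨fun j => if h : j ∈ Finset.range n then b ⟨j, h⟩ else 0, hb.symm.trans ?_⟩
  rw [← Finset.sum_coe_sort (Finset.range n)]
  exact Finset.sum_congr rfl fun j _ => by beta_reduce; rw [dif_pos j.2]

variable [IsTopologicalAddGroup E] [ContinuousConstSMul 𝕜 E]

lemma IsWeightedShift.aeval_e_zero (hT : IsWeightedShift S T w) {P : Polynomial 𝕜}
    (hP0 : P.coeff 0 = 0) : Polynomial.aeval T P (S.e 0) = 0 := by
  have hP : P = P.divX * Polynomial.X := by
    conv_lhs => rw [← P.divX_mul_X_add, hP0, _root_.map_zero, add_zero]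
  rw [hP, map_mul, Polynomial.aeval_X, mul_apply_eq_comp, hT.map_zero, _root_.map_zero]

lemma IsWeightedShift.aeval_e_succ_sub_mem (hT : IsWeightedShift S T w) {P : Polynomial 𝕜}
    (hP0 : P.coeff 0 = 0) (n : ℕ) :
    Polynomial.aeval T P (S.e (n + 1)) - (P.coeff 1 * w (n + 1)) • S.e n ∈ S.initialSpan n := by
  have hP : P = P.divX * Polynomial.X := by
    conv_lhs => rw [← P.divX_mul_X_add, hP0, _root_.map_zero, add_zero]
  have hQ : Polynomial.aeval T P.divX (S.e n) =
      Polynomial.aeval T P.divX.divX (T (S.e n)) + P.coeff 1 • S.e n := by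
    conv_lhs => rw [← P.divX.divX_mul_X_add]
    simp [Polynomial.coeff_divX, Algebra.algebraMap_eq_smul_one]
  have hPe : Polynomial.aeval T P (S.e (n + 1)) =
      w (n + 1) • Polynomial.aeval T P.divX (S.e n) := by
    conv_lhs => rw [hP]
    rw [map_mul, Polynomial.aeval_X, mul_apply_eq_comp, hT.map_succ, map_smul]
  rw [hPe, hQ, smul_add, smul_smul, mul_comm (w (n + 1)), add_sub_cancel_right]
  exact Submodule.smul_mem _ _
    (Polynomial.aeval_apply_mem_of_forall_mem (hT.map_initialSpan n) _ (hT.map_e_mem n))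

/-- Triangular solving: a multiple of `e (n + 1)` matches the leading term, and the induction
hypothesis corrects the lower ones. -/
lemma IsWeightedShift.exists_aeval_eq (hT : IsWeightedShift S T w) {P : Polynomial 𝕜}
    (hP0 : P.coeff 0 = 0) (hP1 : P.coeff 1 ≠ 0) (n : ℕ) :
    ∀ y ∈ S.initialSpan n, ∃ x ∈ S.initialSpan (n + 1), Polynomial.aeval T P x = y := by
  induction n with
  | zero =>
    intro y hy
    have : y = 0 := by simpa [SequenceSpace.initialSpan] using hy
    exact ⟨0, zero_mem _, by simp [this]⟩
  | succ n ih =>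
    intro y hy
    rw [SequenceSpace.initialSpan, Finset.range_add_one, Finset.coe_insert, Set.image_insert_eq,
      Submodule.mem_span_insert] at hy
    obtain ⟨c, z, hz, rfl⟩ := hy
    have ha : P.coeff 1 * w (n + 1) ≠ 0 := mul_ne_zero hP1 (hT.weight_ne_zero n)
    set a := P.coeff 1 * w (n + 1)
    obtain ⟨x, hx, hxz⟩ := ih (z - (c / a) • (Polynomial.aeval T P (S.e (n + 1)) - a • S.e n))
      (sub_mem hz (Submodule.smul_mem _ _ (hT.aeval_e_succ_sub_mem hP0 n)))
    refine ⟨(c / a) • S.e (n + 1) + x, add_mem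
      (Submodule.smul_mem _ _ (S.e_mem_initialSpan (Nat.lt_succ_self _)))
      (S.initialSpan_mono (Nat.le_succ _) hx), ?_⟩
    rw [map_add, map_smul, hxz, smul_sub, smul_smul, div_mul_cancel₀ _ ha]
    abel

lemma IsWeightedShift.exists_isShiftBasis (hT : IsWeightedShift S T w) {P : Polynomial 𝕜}
    (hP0 : P.coeff 0 = 0) (hP1 : P.coeff 1 ≠ 0) :
    ∃ u : ℕ → E, IsShiftBasis S (Polynomial.aeval T P) u := by
  choose! f hf hfA using hT.exists_aeval_eq hP0 hP1
  let u : ℕ → E := fun n => Nat.rec (S.e 0) (fun n y => f (n + 1) y) n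
  have hu : ∀ n, u n ∈ S.initialSpan (n + 1) := by
    intro n
    induction n with
    | zero => exact S.e_mem_initialSpan Nat.zero_lt_one
    | succ n ih => exact hf _ _ ih
  have hA : ∀ n, Polynomial.aeval T P (u (n + 1)) = u n := fun n => hfA _ _ (hu n)
  have hli : LinearIndependent 𝕜 u :=
    linearIndependent_of_backward_shift (A := (Polynomial.aeval T P : E →L[𝕜] E).toLinearMap)
      (hT.aeval_e_zero hP0) (S.e_ne_zero 0) hA
  refine ⟨u, fun n => S.exists_sum_of_mem_initialSpan (hu n), hli, le_antisymm ?_ ?_, hA⟩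
  · rw [Submodule.span_le]
    rintro _ ⟨n, rfl⟩
    exact Submodule.span_mono (Set.image_subset_range _ _) (hu n)
  · rw [Submodule.span_le]
    rintro _ ⟨n, rfl⟩
    have hle : Submodule.span 𝕜 (Set.range fun i : Fin (n + 1) => u i) ≤ S.initialSpan (n + 1) := by
      rw [Submodule.span_le]
      rintro _ ⟨i, rfl⟩
      exact S.initialSpan_mono (by omega) (hu i)
    have hfin : FiniteDimensional 𝕜 (S.initialSpan (n + 1)) :=
      FiniteDimensional.span_of_finite 𝕜 ((Finset.finite_toSet _).image _)
    -- Dimension count: `n + 1` independent vectors in a space spanned by `n + 1` vectors span it.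
    have hdim : Module.finrank 𝕜 (S.initialSpan (n + 1)) ≤
        Module.finrank 𝕜 (Submodule.span 𝕜 (Set.range fun i : Fin (n + 1) => u i)) := by
      have := finrank_span_eq_card (hli.comp (Fin.val (n := n + 1)) Fin.val_injective)
      rw [Fintype.card_fin] at this
      refine le_trans ?_ this.ge
      classical
      rw [SequenceSpace.initialSpan, ← Finset.coe_image]
      exact (finrank_span_finset_le_card _).trans (Finset.card_image_le.trans (by simp))
    have heq := Submodule.eq_of_le_of_finrank_le hle hdim
    have hmem : S.e n ∈ Submodule.span 𝕜 (Set.range fun i : Fin (n + 1) => u i) := by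
      rw [heq]
      exact S.e_mem_initialSpan n.lt_succ_self
    exact Submodule.span_mono (by rintro _ ⟨i, rfl⟩; exact ⟨i, rfl⟩) hmem

lemma IsShiftBasis.map_zero (hT : IsWeightedShift S T w) {P : Polynomial 𝕜}
    (hP0 : P.coeff 0 = 0) {u : ℕ → E} (hu : IsShiftBasis S (Polynomial.aeval T P) u) :
    Polynomial.aeval T P (u 0) = 0 := by
  obtain ⟨b, hb⟩ := hu.triangular 0
  rw [hb]
  simp [hT.aeval_e_zero hP0]

end ShiftBasis

/-! ### Lower density of sets of integers -/

section LowerDensity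

open Classical in
lemma lowerDensity_eq_liminf_count (A : Set ℕ) :
    lowerDensity A =
      liminf (fun N : ℕ => (Nat.count (· ∈ A) (N + 1) : ℝ) / ((N : ℝ) + 1)) atTop := by
  simp only [lowerDensity, Nat.count_eq_card_filter_range]

open Classical in
lemma count_div_mem_Icc (A : Set ℕ) (N : ℕ) :
    (Nat.count (· ∈ A) (N + 1) : ℝ) / ((N : ℝ) + 1) ∈ Set.Icc (0 : ℝ) 1 := by
  refine ⟨by positivity, div_le_one_of_le₀ ?_ (by positivity)⟩
  exact_mod_cast Nat.count_le _

open Classical in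
lemma isBoundedUnder_ge_count_div (A : Set ℕ) : IsBoundedUnder (· ≥ ·) atTop
    (fun N : ℕ => (Nat.count (· ∈ A) (N + 1) : ℝ) / ((N : ℝ) + 1)) :=
  isBoundedUnder_of ⟨0, fun N => (count_div_mem_Icc A N).1⟩

open Classical in
lemma isBoundedUnder_le_count_div (A : Set ℕ) : IsBoundedUnder (· ≤ ·) atTop
    (fun N : ℕ => (Nat.count (· ∈ A) (N + 1) : ℝ) / ((N : ℝ) + 1)) :=
  isBoundedUnder_of ⟨1, fun N => (count_div_mem_Icc A N).2⟩

lemma lowerDensity_mono {A B : Set ℕ} (h : A ⊆ B) : lowerDensity A ≤ lowerDensity B := by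
  classical
  rw [lowerDensity_eq_liminf_count, lowerDensity_eq_liminf_count]
  refine liminf_le_liminf (Eventually.of_forall fun N => ?_) (isBoundedUnder_ge_count_div A)
    (isBoundedUnder_le_count_div B).isCoboundedUnder_ge
  gcongr

open Classical in
lemma lowerDensity_nonpos_iff {A : Set ℕ} :
    lowerDensity A ≤ 0 ↔
      ∀ ε : ℝ, 0 < ε → ∃ᶠ N : ℕ in atTop, (Nat.count (· ∈ A) (N + 1) : ℝ) ≤ ε * (N + 1) := by
  rw [lowerDensity_eq_liminf_count]
  constructor
  · intro h ε hε
    refine (frequently_lt_of_liminf_lt (isBoundedUnder_le_count_div A).isCoboundedUnder_ge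
      (h.trans_lt hε)).mono fun N hN => ?_
    exact ((div_lt_iff₀ (by positivity)).1 hN).le
  · intro h
    by_contra! hpos
    obtain ⟨ε, hε0, hε⟩ := exists_between hpos
    obtain ⟨N, hN, hN'⟩ := ((h ε hε0).and_eventually
      (eventually_lt_of_lt_liminf hε (isBoundedUnder_ge_count_div A))).exists
    rw [lt_div_iff₀ (by positivity)] at hN'
    exact hN'.not_ge hN

open Classical in
lemma lowerDensity_nonpos_of_count_le {A B : Set ℕ}
    (h : ∀ N, Nat.count (· ∈ B) N ≤ Nat.count (· ∈ A) N + 1) (hA : lowerDensity A ≤ 0) :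
    lowerDensity B ≤ 0 := by
  rw [lowerDensity_nonpos_iff] at hA ⊢
  intro ε hε
  obtain ⟨m, hm⟩ := exists_nat_gt (2 / ε)
  refine ((hA (ε / 2) (by positivity)).and_eventually (eventually_ge_atTop m)).mono ?_
  rintro N ⟨hN, hmN⟩
  have h1 : (Nat.count (· ∈ B) (N + 1) : ℝ) ≤ Nat.count (· ∈ A) (N + 1) + 1 := by
    exact_mod_cast h (N + 1)
  have h2 : 1 ≤ ε / 2 * (N + 1) := by
    have : (m : ℝ) ≤ N := by exact_mod_cast hmN
    rw [div_lt_iff₀ hε] at hm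
    nlinarith
  linarith

/-- Shifting the set changes each count by at most one. This makes the set of points with zero
visiting density invariant. -/
lemma lowerDensity_succ_nonpos_iff {A : Set ℕ} :
    lowerDensity {n | n + 1 ∈ A} ≤ 0 ↔ lowerDensity A ≤ 0 := by
  classical
  have h : ∀ N, Nat.count (· ∈ A) (N + 1) =
      Nat.count (· ∈ {n | n + 1 ∈ A}) N + if 0 ∈ A then 1 else 0 := fun N =>
    Nat.count_succ' _ _
  constructor
  · refine lowerDensity_nonpos_of_count_le fun N => ?_
    have h1 := h N
    have h2 : Nat.count (· ∈ A) N ≤ Nat.count (· ∈ A) (N + 1) := Nat.count_monotone _ N.le_succ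
    split_ifs at h1 <;> omega
  · refine lowerDensity_nonpos_of_count_le fun N => ?_
    have h1 := h N
    have h2 := Nat.count_succ (· ∈ A) N
    split_ifs at h1 h2 <;> omega

end LowerDensity

/-! ### Visiting frequencies for measure-preserving maps -/

section Recurrence

variable {α : Type*} {f : α → α}

open Classical in
-- Cut the orbit greedily into blocks: from a point outside `B`, a block of length at most `K` with
-- visiting frequency at most `ε`; from a point of `B`, a single step. The unfinished end costs at
-- most `K`.
lemma count_iterate_le_add_count_iterate {O B : Set α} {ε : ℝ} (hε : 0 ≤ ε) {K : ℕ}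
    (hB : ∀ y ∉ B, ∃ n, 1 ≤ n ∧ n ≤ K ∧ (Nat.count (fun k => f^[k] y ∈ O) n : ℝ) ≤ ε * n)
    (L : ℕ) (x : α) :
    (Nat.count (fun k => f^[k] x ∈ O) L : ℝ) ≤
      ε * L + Nat.count (fun k => f^[k] x ∈ B) L + K := by
  have hadd : ∀ (U : Set α) (x : α) (m n : ℕ), Nat.count (fun k => f^[k] x ∈ U) (m + n) =
      Nat.count (fun k => f^[k] x ∈ U) m + Nat.count (fun k => f^[k] (f^[m] x) ∈ U) n := by
    intro U x m n
    rw [Nat.count_add]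
    congr 2
    ext k
    rw [add_comm, Function.iterate_add_apply]
  induction L using Nat.strong_induction_on generalizing x with
  | _ L ih =>
    by_cases hL : L ≤ K
    · have h1 : (Nat.count (fun k => f^[k] x ∈ O) L : ℝ) ≤ L := by exact_mod_cast Nat.count_le _
      have h2 : (L : ℝ) ≤ K := by exact_mod_cast hL
      have : 0 ≤ ε * L := by positivity
      have : (0 : ℝ) ≤ Nat.count (fun k => f^[k] x ∈ B) L := by positivity
      linarith
    · by_cases hx : x ∈ B
      · obtain ⟨l, rfl⟩ : ∃ l, L = 1 + l := ⟨L - 1, by omega⟩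
        have h1 := ih l (by omega) (f^[1] x)
        rw [hadd O, hadd B]
        have h2 : (Nat.count (fun k => f^[k] x ∈ O) 1 : ℝ) ≤ 1 := by exact_mod_cast Nat.count_le _
        have h3 : Nat.count (fun k => f^[k] x ∈ B) 1 = 1 := by simp [Nat.count_succ, hx]
        rw [h3]
        push_cast
        nlinarith
      · obtain ⟨n, hn1, hnK, hn⟩ := hB x hx
        obtain ⟨l, rfl⟩ : ∃ l, L = n + l := ⟨L - n, by omega⟩
        have h1 := ih l (by omega) (f^[n] x)
        rw [hadd O, hadd B]
        push_cast
        have : (0 : ℝ) ≤ Nat.count (fun k => f^[k] x ∈ B) n := by positivity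
        linarith

variable [MeasurableSpace α] {μ : Measure α} [IsProbabilityMeasure μ]

open Classical in
lemma measurable_count_iterate (hf : Measurable f) {O : Set α} (hO : MeasurableSet O) (n : ℕ) :
    Measurable fun x => (Nat.count (fun k => f^[k] x ∈ O) n : ℝ) := by
  simp_rw [Nat.count_eq_card_filter_range, Finset.card_filter, Nat.cast_sum]
  refine Finset.measurable_sum _ fun k _ => ?_
  simp_rw [Nat.cast_ite]
  exact Measurable.ite (hf.iterate k hO) measurable_const measurable_const

open Classical in
lemma integrable_count_iterate (hf : Measurable f) {O : Set α} (hO : MeasurableSet O) (n : ℕ) :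
    Integrable (fun x => (Nat.count (fun k => f^[k] x ∈ O) n : ℝ)) μ := by
  refine Integrable.of_bound (measurable_count_iterate hf hO n).aestronglyMeasurable n
    (Eventually.of_forall fun x => ?_)
  simpa using Nat.count_le _

open Classical in
lemma integral_count_iterate (hf : MeasurePreserving f μ μ) {O : Set α} (hO : MeasurableSet O)
    (n : ℕ) : ∫ x, (Nat.count (fun k => f^[k] x ∈ O) n : ℝ) ∂μ = n * μ.real O := by
  have h1 : ∀ x, (Nat.count (fun k => f^[k] x ∈ O) n : ℝ) =
      ∑ k ∈ Finset.range n, (f^[k] ⁻¹' O).indicator (fun _ => (1 : ℝ)) x := by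
    intro x
    rw [Nat.count_eq_card_filter_range, Finset.card_filter, Nat.cast_sum]
    refine Finset.sum_congr rfl fun k _ => ?_
    simp [Set.indicator_apply]
  have hm : ∀ k, MeasurableSet (f^[k] ⁻¹' O) := fun k => hf.measurable.iterate k hO
  simp_rw [h1]
  rw [integral_finsetSum _ fun k _ => (integrable_const (1 : ℝ)).indicator (hm k)]
  rw [Finset.sum_congr rfl (g := fun _ => μ.real O), Finset.sum_const, Finset.card_range,
    nsmul_eq_mul]
  intro k _
  rw [integral_indicator_const _ (hm k), smul_eq_mul, mul_one]
  exact (hf.iterate k).measureReal_preimage hO.nullMeasurableSet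

open Classical in
-- Integrate the block estimate over orbits of length `L`, divide by `L`, and let `L → ∞`.
lemma measureReal_le_add_of_forall_exists_count_le (hf : MeasurePreserving f μ μ) {O B : Set α}
    (hO : MeasurableSet O) (hB : MeasurableSet B) {ε : ℝ} (hε : 0 ≤ ε) {K : ℕ}
    (hcov : ∀ y ∉ B, ∃ n, 1 ≤ n ∧ n ≤ K ∧
      (Nat.count (fun k => f^[k] y ∈ O) n : ℝ) ≤ ε * n) :
    μ.real O ≤ ε + μ.real B := by
  have hL : ∀ L : ℕ, L * μ.real O ≤ ε * L + L * μ.real B + K := by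
    intro L
    rw [← integral_count_iterate hf hO, ← integral_count_iterate hf (hB)]
    have hi := integrable_count_iterate (μ := μ) hf.measurable (hB) L
    have hi' : Integrable
        (fun x => ε * L + (Nat.count (fun k => f^[k] x ∈ B) L : ℝ)) μ :=
      (integrable_const _).add hi
    calc _ ≤ ∫ x, (ε * L + Nat.count (fun k => f^[k] x ∈ B) L + K) ∂μ :=
          integral_mono (integrable_count_iterate hf.measurable hO L)
            (hi'.add (integrable_const _))
            fun x => count_iterate_le_add_count_iterate hε (hcov) L x
      _ = _ := by
        rw [integral_add hi' (integrable_const _),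
          integral_add (integrable_const _) hi]
        simp
  by_contra! hlt
  obtain ⟨L, hLK⟩ := exists_nat_gt ((K : ℝ) / (μ.real O - (ε + μ.real B)))
  rw [div_lt_iff₀ (by linarith)] at hLK
  have := hL L
  nlinarith

/-- If almost every orbit has an initial segment with visiting frequency at most `ε`, then the
visited set has measure at most `ε`. -/
lemma measureReal_le_of_ae_exists_count_le (hf : MeasurePreserving f μ μ) {O : Set α}
    (hO : MeasurableSet O) {ε : ℝ} (hε : 0 ≤ ε)
    (h : open Classical in ∀ᵐ x ∂μ, ∃ n, 1 ≤ n ∧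
      (Nat.count (fun k => f^[k] x ∈ O) n : ℝ) ≤ ε * n) :
    μ.real O ≤ ε := by
  classical
  let B : ℕ → Set α := fun K => {y | ¬ ∃ n, 1 ≤ n ∧ n ≤ K ∧
        (Nat.count (fun k => f^[k] y ∈ O) n : ℝ) ≤ ε * n}
  have hB : ∀ K, MeasurableSet (B K) := by
    intro K
    have : B K = (⋃ n ∈ Finset.Icc 1 K,
        {y | (Nat.count (fun k => f^[k] y ∈ O) n : ℝ) ≤ ε * n})ᶜ := by
      ext y
      simp only [B, Set.mem_ofPred_eq, Set.mem_compl_iff, Set.mem_iUnion, Finset.mem_Icc]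
      simp only [exists_prop, and_assoc]
    rw [this]
    exact (Finset.measurableSet_biUnion _ fun n _ =>
      measurableSet_le (measurable_count_iterate hf.measurable hO n) measurable_const).compl
  have hle : ∀ K, μ.real O ≤ ε + μ.real (B K) := fun K =>
    measureReal_le_add_of_forall_exists_count_le hf hO (hB K) hε fun y hy => not_not.1 hy
  have hlim : Tendsto (fun K => μ.real (B K)) atTop (𝓝 0) := by
    have hanti : Antitone B := by
      rintro K K' hK y hy ⟨n, hn1, hnK, hn⟩
      exact hy ⟨n, hn1, hnK.trans hK, hn⟩
    have hnull : μ (⋂ K, B K) = 0 := by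
      refine measure_mono_null ?_ h
      intro y hy ⟨n, hn1, hn⟩
      exact Set.mem_iInter.1 hy n ⟨n, hn1, le_rfl, hn⟩
    have := tendsto_measure_iInter_atTop (μ := μ) (fun K => (hB K).nullMeasurableSet) hanti
      ⟨0, measure_ne_top _ _⟩
    rw [hnull] at this
    exact (ENNReal.tendsto_toReal ENNReal.zero_ne_top).comp this
  have := ge_of_tendsto (hlim.const_add ε) (Eventually.of_forall hle)
  simpa using this

lemma measure_eq_zero_of_ae_lowerDensity_nonpos (hf : MeasurePreserving f μ μ) {O : Set α}
    (hO : MeasurableSet O) (h : ∀ᵐ x ∂μ, lowerDensity {n | f^[n] x ∈ O} ≤ 0) : μ O = 0 := by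
  classical
  have key : μ.real O ≤ 0 := by
    refine le_of_forall_pos_le_add fun ε hε => ?_
    rw [zero_add]
    refine measureReal_le_of_ae_exists_count_le hf hO hε.le ?_
    filter_upwards [h] with x hx
    obtain ⟨N, hN⟩ := (lowerDensity_nonpos_iff.1 hx ε hε).exists
    exact ⟨N + 1, by omega, by simpa using hN⟩
  exact (measureReal_eq_zero_iff).1 (le_antisymm key measureReal_nonneg)

end Recurrence

/-! ### From exactness to frequent hypercyclicity -/

section Exact

variable {α : Type*} [m : MeasurableSpace α] {f : α → α} {μ : Measure α}

lemma measurable_lowerDensity_iterate (hf : Measurable f) {O : Set α} (hO : MeasurableSet O) :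
    Measurable fun x => lowerDensity {n | f^[n] x ∈ O} := by
  classical
  simp_rw [lowerDensity_eq_liminf_count]
  exact Measurable.liminf fun N => (measurable_count_iterate hf hO (N + 1)).div_const _

lemma IsExactMeasure.measure_eq_zero_or_one_of_preimage_eq (h : IsExactMeasure f μ) {B : Set α}
    (hB : MeasurableSet B) (hfB : f ⁻¹' B = B) : μ B = 0 ∨ μ B = 1 := by
  refine h.exact B ?_
  rw [MeasurableSpace.measurableSet_iInf]
  intro n
  refine ⟨B, hB, ?_⟩
  induction n with
  | zero => rfl
  | succ n ih => rw [Function.iterate_succ, Set.preimage_comp, ih, hfB]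

/-- The points whose visits have zero lower density form an invariant set, of measure `0` or `1` by
exactness; measure `1` would force `O` to be null. -/
lemma IsExactMeasure.ae_lowerDensity_pos (h : IsExactMeasure f μ) {O : Set α}
    (hO : MeasurableSet O) (hO0 : μ O ≠ 0) : ∀ᵐ x ∂μ, 0 < lowerDensity {n | f^[n] x ∈ O} := by
  have := h.isProbabilityMeasure
  have hZ : MeasurableSet {x | lowerDensity {n | f^[n] x ∈ O} ≤ 0} :=
    measurableSet_le (measurable_lowerDensity_iterate h.measurePreserving.measurable hO)
      measurable_const
  have hinv : f ⁻¹' {x | lowerDensity {n | f^[n] x ∈ O} ≤ 0} =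
      {x | lowerDensity {n | f^[n] x ∈ O} ≤ 0} := by
    ext x
    exact lowerDensity_succ_nonpos_iff (A := {n | f^[n] x ∈ O})
  rcases h.measure_eq_zero_or_one_of_preimage_eq hZ hinv with h0 | h1
  · simpa [ae_iff] using h0
  · refine absurd (measure_eq_zero_of_ae_lowerDensity_nonpos h.measurePreserving hO ?_) hO0
    exact (prob_compl_eq_zero_iff hZ).2 h1

lemma IsExactMeasure.ae_isFrequentlyHypercyclic [TopologicalSpace α] [SecondCountableTopology α]
    [OpensMeasurableSpace α] [μ.IsOpenPosMeasure] (h : IsExactMeasure f μ) :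
    ∀ᵐ x ∂μ, IsFrequentlyHypercyclic f x := by
  have hb := TopologicalSpace.isBasis_countableBasis α
  have hall : ∀ᵐ x ∂μ, ∀ U ∈ TopologicalSpace.countableBasis α,
      0 < lowerDensity {n | f^[n] x ∈ U} := by
    refine (ae_ball_iff (TopologicalSpace.countable_countableBasis α)).2 fun U hU => ?_
    exact h.ae_lowerDensity_pos (hb.isOpen hU).measurableSet
      ((hb.isOpen hU).measure_ne_zero μ (TopologicalSpace.nonempty_of_mem_countableBasis hU))
  filter_upwards [hall] with x hx O hO ⟨y, hy⟩
  obtain ⟨U, hU, -, hUO⟩ := hb.exists_subset_of_mem_open hy hO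
  exact (hx U hU).trans_le (lowerDensity_mono fun n hn => hUO hn)

end Exact

/-! ### Laws of full support with prescribed tails -/

section FullSupport

open scoped ENNReal

/-- On a separable space there is a probability measure of full support giving summable mass to any
prescribed sequence of measurable sets that is point finite. -/
lemma exists_isProbabilityMeasure_isOpenPosMeasure_tsum_ne_top {X : Type*} [TopologicalSpace X]
    [TopologicalSpace.SeparableSpace X] [Nonempty X] [MeasurableSpace X]
    {B : ℕ → Set X} (hB : ∀ n, MeasurableSet (B n)) (hfin : ∀ x, {n | x ∈ B n}.Finite) :
    ∃ ν : Measure X, IsProbabilityMeasure ν ∧ ν.IsOpenPosMeasure ∧ ∑' n, ν (B n) ≠ ∞ := by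
  let q := TopologicalSpace.denseSeq X
  let κ : ℕ → ℝ≥0∞ := fun j => ∑' n, Measure.dirac (q j) (B n)
  have hκ : ∀ j, κ j ≠ ∞ := by
    intro j
    have : κ j = ∑ n ∈ (hfin (q j)).toFinset, Measure.dirac (q j) (B n) :=
      tsum_eq_sum fun n hn => by
        rw [Measure.dirac_apply' _ (hB n)]
        simpa using hn
    rw [this]
    exact ENNReal.sum_ne_top.2 fun n _ => measure_ne_top _ _
  -- Point masses sit on a dense sequence. The weights beat `κ j`, the number of sets `B n`
  -- containing `q j`; the `+ 1` also keeps the total mass finite.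
  obtain ⟨δ, hδ, hδs⟩ := ENNReal.exists_pos_tsum_mul_lt_of_countable one_ne_zero
    (fun j => κ j + 1) fun j => by simpa using hκ j
  let ρ : Measure X := Measure.sum fun j => (δ j : ℝ≥0∞) • Measure.dirac (q j)
  have hρ : ∀ s, MeasurableSet s → ρ s = ∑' j, δ j * Measure.dirac (q j) s := fun s hs => by
    simp [ρ, Measure.sum_apply _ hs]
  -- Open sets need not be measurable here, so a lower bound for arbitrary sets is needed.
  have hle : ∀ s, ρ s ≥ ∑' j, δ j * Measure.dirac (q j) s := fun s => by
    have := Measure.le_sum_apply (fun j => (δ j : ℝ≥0∞) • Measure.dirac (q j)) s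
    simpa [ρ] using this
  have hρpos : ∀ U : Set X, IsOpen U → U.Nonempty → ρ U ≠ 0 := by
    intro U hU hne
    obtain ⟨_, hx, j, rfl⟩ :=
      (TopologicalSpace.denseRange_denseSeq X).inter_open_nonempty U hU hne
    intro h0
    have h1 : δ j * Measure.dirac (q j) U ≤ ρ U :=
      (ENNReal.le_tsum (f := fun j => δ j * Measure.dirac (q j) U) j).trans (hle U)
    rw [h0, Measure.dirac_apply_of_mem hx, mul_one, nonpos_iff_eq_zero] at h1
    exact (hδ j).ne' (by exact_mod_cast h1)
  have huniv : ρ Set.univ ≠ ∞ := by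
    rw [hρ _ MeasurableSet.univ]
    refine ((ENNReal.tsum_le_tsum fun j => ?_).trans_lt (hδs.trans ENNReal.one_lt_top)).ne
    rw [measure_univ, mul_one]
    exact le_mul_of_one_le_left zero_le le_add_self
  have huniv0 : ρ Set.univ ≠ 0 := hρpos _ isOpen_univ Set.univ_nonempty
  have hsum : ∑' n, ρ (B n) ≠ ∞ := by
    simp_rw [hρ _ (hB _)]
    rw [ENNReal.tsum_comm]
    simp_rw [ENNReal.tsum_mul_left]
    refine ((ENNReal.tsum_le_tsum fun j => ?_).trans_lt (hδs.trans ENNReal.one_lt_top)).ne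
    rw [mul_comm]
    gcongr
    exact le_self_add
  refine ⟨(ρ Set.univ)⁻¹ • ρ, ⟨?_⟩, ⟨fun U hU hne => ?_⟩, ?_⟩
  · simp [ENNReal.inv_mul_cancel huniv0 huniv]
  · simpa [huniv] using hρpos U hU hne
  · simp only [Measure.smul_apply, smul_eq_mul, ENNReal.tsum_mul_left]
    exact ENNReal.mul_ne_top (ENNReal.inv_ne_top.2 huniv0) hsum

lemma infinitePi_ne_zero_of_isOpen {ι X : Type*} [TopologicalSpace X] [MeasurableSpace X]
    [OpensMeasurableSpace X] {ν : Measure X} [IsProbabilityMeasure ν] [ν.IsOpenPosMeasure]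
    {U : Set (ι → X)} (hU : IsOpen U) (hne : U.Nonempty) :
    Measure.infinitePi (fun _ : ι => ν) U ≠ 0 := by
  obtain ⟨x, hx⟩ := hne
  obtain ⟨I, t, ht, hIU⟩ := isOpen_pi_iff.1 hU x hx
  refine fun h0 => ?_
  have h1 := measure_mono_null hIU h0
  rw [Measure.infinitePi_pi _ fun i hi => (ht i hi).1.measurableSet, Finset.prod_eq_zero_iff] at h1
  obtain ⟨i, hi, h⟩ := h1
  exact (ht i hi).1.measure_ne_zero ν ⟨x i, (ht i hi).2⟩ h

end FullSupport

/-! ### The Bernoulli shift and Kolmogorov's zero-one law -/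

section ShiftOnSequences

variable {X : Type*} [m : MeasurableSpace X] {ν : Measure X} [IsProbabilityMeasure ν]

lemma measurable_shift_iSup_comap (n : ℕ) :
    @Measurable (ℕ → X) (ℕ → X) (⨆ i ∈ {i | n ≤ i}, MeasurableSpace.comap (fun x => x i) m) _
      (fun x k => x (k + n)) := by
  rw [@measurable_pi_iff]
  intro k
  refine Measurable.of_comap_le ?_
  exact le_iSup₂_of_le (f := fun i (_ : i ∈ {i | n ≤ i}) =>
    MeasurableSpace.comap (fun x : ℕ → X => x i) m) (k + n) (Nat.le_add_left n k) le_rfl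

lemma iIndep_comap_eval_infinitePi :
    iIndep (fun i : ℕ => MeasurableSpace.comap (fun x : ℕ → X => x i) m)
      (Measure.infinitePi fun _ : ℕ => ν) :=
  iIndepFun_infinitePi (P := fun _ : ℕ => ν) (X := fun _ x => x) fun _ => measurable_id

lemma comap_eval_le (i : ℕ) :
    MeasurableSpace.comap (fun x : ℕ → X => x i) m ≤ MeasurableSpace.pi :=
  (measurable_pi_apply i).comap_le

lemma measurePreserving_shift_infinitePi (n : ℕ) :
    MeasurePreserving (fun (x : ℕ → X) k => x (k + n)) (Measure.infinitePi fun _ : ℕ => ν)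
      (Measure.infinitePi fun _ : ℕ => ν) :=
  ⟨by fun_prop, Measure.map_infinitePi_infinitePi_of_inj (P := fun _ : ℕ => ν)
    (f := fun k => k + n) (add_left_injective n)⟩

/-- A set that agrees almost surely, for every `n`, with an event depending only on the coordinates
from `n` on has probability `0` or `1`. -/
lemma infinitePi_eq_zero_or_one_of_ae_eq_shift {C : Set (ℕ → X)} {G : ℕ → Set (ℕ → X)}
    (hG : ∀ n, MeasurableSet (G n))
    (hCG : ∀ n, ∀ᵐ x ∂(Measure.infinitePi fun _ : ℕ => ν), x ∈ C ↔ (fun k => x (k + n)) ∈ G n) :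
    Measure.infinitePi (fun _ : ℕ => ν) C = 0 ∨ Measure.infinitePi (fun _ : ℕ => ν) C = 1 := by
  -- `D` is a genuine tail event that agrees with `C` almost surely.
  let D : Set (ℕ → X) := {x | ∃ᶠ n in atTop, (fun k => x (k + n)) ∈ G n}
  have hae : C =ᵐ[Measure.infinitePi fun _ : ℕ => ν] D := by
    filter_upwards [ae_all_iff.2 hCG] with x hx
    change (x ∈ C) = (x ∈ D)
    by_cases h : x ∈ C
    · have : x ∈ D := Eventually.frequently (Eventually.of_forall fun n => (hx n).1 h)
      simp [h, this]
    · have : x ∉ D := by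
        refine fun hD => ?_
        obtain ⟨n, hn⟩ := hD.exists
        exact h ((hx n).2 hn)
      simp [h, this]
  rw [measure_congr hae]
  refine measure_zero_or_one_of_measurableSet_limsup_atTop (fun i => comap_eval_le i)
    iIndep_comap_eval_infinitePi ?_
  rw [limsup_eq_iInf_iSup_of_nat, MeasurableSpace.measurableSet_iInf]
  intro N
  have hD : D = ⋂ K, ⋃ n ∈ {n | N + K ≤ n}, (fun x k => x (k + n)) ⁻¹' G n := by
    ext x
    simp only [D, Set.mem_iInter, Set.mem_iUnion, Set.mem_preimage, exists_prop]
    change (∃ᶠ n in atTop, (fun k => x (k + n)) ∈ G n) ↔ _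
    rw [frequently_atTop]
    constructor
    · exact fun h K => h (N + K)
    · intro h K
      obtain ⟨n, hn, hx⟩ := h K
      exact ⟨n, le_trans (Nat.le_add_left K N) hn, hx⟩
  rw [hD]
  refine MeasurableSet.iInter fun K => MeasurableSet.biUnion (Set.to_countable _) fun n hn => ?_
  have hle : (⨆ i ∈ {i | n ≤ i}, MeasurableSpace.comap (fun x : ℕ → X => x i) m) ≤
      ⨆ i ≥ N, MeasurableSpace.comap (fun x : ℕ → X => x i) m :=
    biSup_mono fun i hi => le_trans (le_trans (Nat.le_add_right N K) hn) hi
  exact hle _ (measurable_shift_iSup_comap n (hG n))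

end ShiftOnSequences

/-! ### The law of the random series -/

section RandomSeries

variable {𝕜 E : Type*} [RCLike 𝕜] [AddCommGroup E] [Module 𝕜 E] [UniformSpace E]
  [IsUniformAddGroup E] [ContinuousSMul 𝕜 E] [T2Space E] [IsCountablyGenerated (𝓤 E)]
  [CompleteSpace E] [SecondCountableTopology E] [MeasurableSpace E] [BorelSpace E]

lemma measurable_tsum_smul (u : ℕ → E) : Measurable fun x : ℕ → 𝕜 => ∑' n, x n • u n := by
  classical
  have hterm : ∀ n, Measurable fun x : ℕ → 𝕜 => x n • u n := fun n =>
    (show Continuous fun x : ℕ → 𝕜 => x n • u n by fun_prop).measurable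
  have hsum : ∀ s : Finset ℕ, Measurable fun x : ℕ → 𝕜 => ∑ n ∈ s, x n • u n := fun s =>
    Finset.measurable_sum _ fun n _ => hterm n
  have hD : MeasurableSet {x : ℕ → 𝕜 | Summable fun n => x n • u n} :=
    measurableSet_exists_tendsto (l := (SummationFilter.unconditional ℕ).filter) hsum
  refine measurable_of_tendsto_metrizable (f := fun N x =>
    if x ∈ {x : ℕ → 𝕜 | Summable fun n => x n • u n} then ∑ n ∈ Finset.range N, x n • u n else 0)
    (fun N => Measurable.ite hD (hsum _) measurable_const) ?_
  rw [tendsto_pi_nhds]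
  intro x
  by_cases hx : Summable fun n => x n • u n
  · have : x ∈ {x : ℕ → 𝕜 | Summable fun n => x n • u n} := hx
    simp only [this, if_true]
    exact hx.hasSum.tendsto_sum_nat
  · have : x ∉ {x : ℕ → 𝕜 | Summable fun n => x n • u n} := hx
    simp only [this, if_false, tsum_eq_zero_of_not_summable hx]
    exact tendsto_const_nhds

omit [IsCountablyGenerated (𝓤 E)] [CompleteSpace E] [SecondCountableTopology E]
  [MeasurableSpace E] [BorelSpace E] [ContinuousSMul 𝕜 E] in
lemma iterate_tsum_smul {A : E →L[𝕜] E} {u : ℕ → E} (h0 : A (u 0) = 0)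
    (hA : ∀ n, A (u (n + 1)) = u n) (n : ℕ) {x : ℕ → 𝕜} (hx : Summable fun n => x n • u n) :
    A^[n] (∑' k, x k • u k) = ∑' k, x (k + n) • u k := by
  have key : ∀ x : ℕ → 𝕜, (Summable fun n => x n • u n) →
      (Summable fun n => x (n + 1) • u n) ∧ A (∑' k, x k • u k) = ∑' k, x (k + 1) • u k := by
    intro x hx
    have hs := (summable_nat_add_iff 1).2 (hx.map A A.continuous)
    have he : ∀ k, A (x (k + 1) • u (k + 1)) = x (k + 1) • u k := fun k => by
      rw [map_smul, hA]
    refine ⟨by simpa [Function.comp_def, he] using hs, ?_⟩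
    rw [A.map_tsum hx, (show Summable fun k => A (x k • u k) from
      hx.map A A.continuous).tsum_eq_zero_add]
    simp [h0, hA]
  induction n generalizing x with
  | zero => rfl
  | succ n ih =>
    rw [Function.iterate_succ_apply, (key x hx).2, ih (key x hx).1]
    simp only [add_assoc]

variable {ν : Measure 𝕜} [IsProbabilityMeasure ν] {A : E →L[𝕜] E} {u : ℕ → E}

/-- The sum map almost surely intertwines the coordinate shift with `A`. Hence the preimage of a set
in `⋂ₙ A⁻ⁿ(𝓑)` agrees almost surely, for each `n`, with an event in the coordinates from `n` on. -/
lemma isExactMeasure_map_tsum_smul (h0 : A (u 0) = 0) (hA : ∀ n, A (u (n + 1)) = u n)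
    (hs : ∀ᵐ x ∂(Measure.infinitePi fun _ : ℕ => ν), Summable fun n => x n • u n) :
    IsExactMeasure A ((Measure.infinitePi fun _ : ℕ => ν).map fun x => ∑' n, x n • u n) where
  isProbabilityMeasure := Measure.isProbabilityMeasure_map (measurable_tsum_smul u).aemeasurable
  measurePreserving := by
    refine ⟨A.continuous.measurable, ?_⟩
    rw [Measure.map_map A.continuous.measurable (measurable_tsum_smul u)]
    have hae : (A ∘ fun x : ℕ → 𝕜 => ∑' n, x n • u n)
        =ᵐ[Measure.infinitePi fun _ : ℕ => ν]
        (fun x : ℕ → 𝕜 => ∑' n, x n • u n) ∘ fun x k => x (k + 1) := by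
      filter_upwards [hs] with x hx
      exact iterate_tsum_smul h0 hA 1 hx
    rw [Measure.map_congr hae, ← Measure.map_map (measurable_tsum_smul u) (by fun_prop),
      (measurePreserving_shift_infinitePi 1).map_eq]
  exact := by
    intro B hB
    rw [MeasurableSpace.measurableSet_iInf] at hB
    choose G hG hGB using hB
    have hBm : MeasurableSet B := by
      rw [← hGB 0]
      exact hG 0
    rw [Measure.map_apply (measurable_tsum_smul u) hBm]
    refine infinitePi_eq_zero_or_one_of_ae_eq_shift
      (G := fun n => (fun x : ℕ → 𝕜 => ∑' n, x n • u n) ⁻¹' G n)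
      (fun n => measurable_tsum_smul u (hG n)) fun n => ?_
    filter_upwards [hs] with x hx
    rw [Set.mem_preimage, Set.mem_preimage, ← iterate_tsum_smul h0 hA n hx, ← Set.mem_preimage,
      ← hGB n]
    rfl

/-- Near a finite combination `y ∈ O`, the head is close to `y` with positive probability, some late
tail is small with positive probability, and the two are independent. -/
lemma isOpenPosMeasure_map_tsum_smul [ν.IsOpenPosMeasure]
    (hu : Dense (Submodule.span 𝕜 (Set.range u) : Set E))
    (hs : ∀ᵐ x ∂(Measure.infinitePi fun _ : ℕ => ν), Summable fun n => x n • u n) :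
    ((Measure.infinitePi fun _ : ℕ => ν).map fun x => ∑' n, x n • u n).IsOpenPosMeasure where
  open_pos := by
    intro O hO hne
    set π := Measure.infinitePi fun _ : ℕ => ν
    rw [Measure.map_apply (measurable_tsum_smul u) hO.measurableSet]
    obtain ⟨y, hyO, hy⟩ := hu.inter_open_nonempty O hO hne
    obtain ⟨c, hc⟩ := Finsupp.mem_span_range_iff_exists_finsupp.1 hy
    have hadd : Tendsto (fun p : E × E => p.1 + p.2) (𝓝 y ×ˢ 𝓝 0) (𝓝 y) := by
      simpa [nhds_prod_eq] using (continuous_add (M := E)).tendsto (y, (0 : E))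
    obtain ⟨O₁, hO₁, V₁, hV₁, hOV⟩ := mem_prod_iff.1 (hadd (hO.mem_nhds hyO))
    obtain ⟨O', hO'O, hO', hyO'⟩ := mem_nhds_iff.1 hO₁
    obtain ⟨V, hVV, hV, h0V⟩ := mem_nhds_iff.1 hV₁
    let tail : ℕ → (ℕ → 𝕜) → E := fun N x => ∑' k, x (k + N) • u (k + N)
    have htail : ∀ N, Measurable[⨆ i ∈ {i | N ≤ i},
        MeasurableSpace.comap (fun x : ℕ → 𝕜 => x i) inferInstance] (tail N) := fun N =>
      (measurable_tsum_smul fun k => u (k + N)).comp (measurable_shift_iSup_comap N)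
    obtain ⟨N, hN, hNpos⟩ : ∃ N, c.support.sup id + 1 ≤ N ∧ π (tail N ⁻¹' V) ≠ 0 := by
      by_contra! hcon
      have hnull : π (⋃ N ∈ {N | c.support.sup id + 1 ≤ N}, tail N ⁻¹' V) = 0 :=
        (measure_biUnion_null_iff (Set.to_countable _)).2 hcon
      have huniv : (⋃ N ∈ {N | c.support.sup id + 1 ≤ N}, tail N ⁻¹' V) = Set.univ := by
        refine Set.eq_univ_of_forall fun x => ?_
        -- This holds for every `x`: without summability the tails have the default sum `0`.
        have hlim := tendsto_sum_nat_add fun n => x n • u n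
        obtain ⟨N, hxN, hN⟩ := ((hlim.eventually (hV.mem_nhds h0V)).and
          (eventually_ge_atTop (c.support.sup id + 1))).exists
        exact Set.mem_biUnion (x := N) hN hxN
      rw [huniv, measure_univ] at hnull
      exact one_ne_zero hnull
    let head : (ℕ → 𝕜) → E := fun x => ∑ n ∈ Finset.range N, x n • u n
    have hheadc : Continuous head := by fun_prop
    have hhead : Measurable[⨆ i ∈ {i | i < N},
        MeasurableSpace.comap (fun x : ℕ → 𝕜 => x i) inferInstance] head := by
      refine Finset.measurable_sum _ fun n hn => ?_
      have h1 : Measurable[⨆ i ∈ {i | i < N},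
          MeasurableSpace.comap (fun x : ℕ → 𝕜 => x i) inferInstance]
          fun x : ℕ → 𝕜 => x n :=
        Measurable.of_comap_le (le_iSup₂_of_le (f := fun i (_ : i ∈ {i | i < N}) =>
          MeasurableSpace.comap (fun x : ℕ → 𝕜 => x i) inferInstance) n
          (Finset.mem_range.1 hn) le_rfl)
      exact (show Continuous fun a : 𝕜 => a • u n by fun_prop).measurable.comp h1
    have hheadpos : π (head ⁻¹' O') ≠ 0 := by
      refine infinitePi_ne_zero_of_isOpen (hO'.preimage hheadc) ⟨c, ?_⟩
      have : head c = y := by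
        rw [← hc]
        refine (Finsupp.sum_of_support_subset c (fun n hn => ?_) (fun n a => a • u n)
          fun n _ => zero_smul 𝕜 (u n)).symm
        have : n ≤ c.support.sup id := Finset.le_sup (f := id) hn
        exact Finset.mem_range.2 (by omega)
      rw [Set.mem_preimage, this]
      exact hyO'
    have hindep := indep_iSup_of_disjoint (fun i => comap_eval_le i)
      (iIndep_comap_eval_infinitePi (ν := ν)) (S := {i | i < N}) (T := {i | N ≤ i})
      (Set.disjoint_left.2 fun i hi hi' => absurd (show i < N from hi) (not_lt.2 hi'))
    have hprod := (Indep_iff _ _ _).1 hindep _ _ (hhead hO'.measurableSet)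
      (htail N hV.measurableSet)
    have hsub : ∀ᵐ x ∂π, x ∈ head ⁻¹' O' ∩ tail N ⁻¹' V →
        x ∈ (fun x : ℕ → 𝕜 => ∑' n, x n • u n) ⁻¹' O := by
      filter_upwards [hs] with x hx ⟨hx1, hx2⟩
      rw [Set.mem_preimage, ← hx.sum_add_tsum_nat_add N]
      exact hOV (Set.mk_mem_prod (hO'O hx1) (hVV hx2))
    intro hzero
    exact mul_ne_zero hheadpos hNpos (hprod.symm.trans (measure_mono_null_ae hsub hzero))

end RandomSeries

/-- By Borel–Cantelli, almost surely only finitely many coordinates exceed the admissible bound, and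
finitely many terms do not affect summability. -/
lemma ae_infinitePi_summable_smul {𝕜 E : Type*} [RCLike 𝕜] [AddCommGroup E] [Module 𝕜 E]
    [UniformSpace E] [IsUniformAddGroup E] {ν : Measure 𝕜} [IsProbabilityMeasure ν] {u : ℕ → E}
    {M : ℕ → ℕ} (hM : ∀ c : ℕ → 𝕜, (∀ n, ‖c n‖ ≤ M n) → Summable fun n => c n • u n)
    (hν : ∑' n, ν {a | (M n : ℝ) < ‖a‖} ≠ ⊤) :
    ∀ᵐ x ∂(Measure.infinitePi fun _ : ℕ => ν), Summable fun n => x n • u n := by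
  have hsum : ∑' n, Measure.infinitePi (fun _ : ℕ => ν) {x | (M n : ℝ) < ‖x n‖} ≠ ⊤ := by
    convert hν using 3 with n
    exact (measurePreserving_eval_infinitePi (fun _ : ℕ => ν) n).measure_preimage
      (measurableSet_lt measurable_const measurable_norm).nullMeasurableSet
  filter_upwards [ae_eventually_notMem hsum] with x hx
  have hx' : ∀ᶠ n in atTop, ‖x n‖ ≤ M n := hx.mono fun n hn => not_lt.1 hn
  refine (hM (fun n => if ‖x n‖ ≤ M n then x n else 0) fun n => ?_).congr_cofinite ?_
  · split_ifs with h
    · exact h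
    · simp
  · rw [Nat.cofinite_eq_atTop]
    filter_upwards [hx'] with n hn
    rw [if_pos hn]

theorem mainTheorem5 {𝕜 : Type*} [RCLike 𝕜] {E : Type*} [AddCommGroup E] [Module 𝕜 E]
    [Module ℝ E] [IsScalarTower ℝ 𝕜 E]
    -- `E` is an F-space
    [UniformSpace E] [IsUniformAddGroup E] [ContinuousSMul 𝕜 E] [T2Space E]
    [IsCountablyGenerated (𝓤 E)] [CompleteSpace E]
    [MeasurableSpace E] [BorelSpace E]
    (hE : IsLocallyBounded 𝕜 E ∨ LocallyConvexSpace ℝ E)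
    -- `E` is a sequence space in which the canonical unit sequences span a dense subspace
    (S : SequenceSpace 𝕜 E)
    (hdense : Dense (Submodule.span 𝕜 (Set.range S.e) : Set E))
    (T : E →L[𝕜] E) (w : ℕ → 𝕜) (hT : IsWeightedShift S T w)
    (P : Polynomial 𝕜) (hP0 : P.coeff 0 = 0) (hP1 : P.coeff 1 ≠ 0) :
    (∃ u : ℕ → E, IsShiftBasis S (Polynomial.aeval T P) u) ∧
    ∀ u : ℕ → E, IsShiftBasis S (Polynomial.aeval T P) u → Summable u →
      -- `ν` is the law of the scalar random variable `X` with full support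
      ∃ ν : Measure 𝕜, IsProbabilityMeasure ν ∧ ν.IsOpenPosMeasure ∧
        -- for every i.i.d. sequence with law `ν`, on any probability space
        ∀ {Ω : Type*} [MeasurableSpace Ω] (μ : Measure Ω) [IsProbabilityMeasure μ]
          (X : ℕ → Ω → 𝕜), iIndepFun X μ → (∀ n, HasLaw (X n) ν μ) →
          (∀ᵐ ω ∂μ, Summable (fun n => X n ω • u n)) ∧
          AEMeasurable (fun ω => ∑' n, X n ω • u n) μ ∧
          (∀ᵐ ω ∂μ, IsFrequentlyHypercyclic (Polynomial.aeval T P) (∑' n, X n ω • u n)) ∧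
          IsExactMeasure (Polynomial.aeval T P) (μ.map (fun ω => ∑' n, X n ω • u n)) ∧
          (μ.map (fun ω => ∑' n, X n ω • u n)).IsOpenPosMeasure := by
  refine ⟨hT.exists_isShiftBasis hP0 hP1, fun u hu hsum => ?_⟩
  have hsep : TopologicalSpace.SeparableSpace E :=
    TopologicalSpace.isSeparable_univ_iff.1 <| by
      rw [← hdense.closure_eq]
      exact ((Set.countable_range S.e).isSeparable.span (R := 𝕜)).closure
  have hsc : SecondCountableTopology E := UniformSpace.secondCountable_of_separable E
  obtain ⟨M, hMlim, hM⟩ := hsum.exists_tendsto_atTop_summable_smul (𝕜 := 𝕜) hE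
  -- Each scalar lies in only finitely many of these sets because `M` tends to infinity.
  obtain ⟨ν, hν, hνpos, hνM⟩ := exists_isProbabilityMeasure_isOpenPosMeasure_tsum_ne_top
    (B := fun n => {a : 𝕜 | (M n : ℝ) < ‖a‖})
    (fun n => measurableSet_lt measurable_const measurable_norm) fun a => by
      obtain ⟨k, hk⟩ := exists_nat_ge ‖a‖
      obtain ⟨N, hN⟩ := eventually_atTop.1 (hMlim.eventually_ge_atTop k)
      refine (Set.finite_lt_nat N).subset fun n hn => ?_
      by_contra! hNn
      have h1 : (k : ℝ) ≤ M n := by exact_mod_cast hN n (not_lt.1 hNn)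
      exact (not_lt.2 (hk.trans h1)) hn
  refine ⟨ν, hν, hνpos, fun {Ω} _ μ _ X hX hlaw => ?_⟩
  have hs := ae_infinitePi_summable_smul hM hνM
  have hXm : AEMeasurable (fun ω n => X n ω) μ :=
    aemeasurable_pi_iff.2 fun n => (hlaw n).aemeasurable
  have hmap : μ.map (fun ω n => X n ω) = Measure.infinitePi fun _ : ℕ => ν := by
    rw [(iIndepFun_iff_map_fun_eq_infinitePi_map₀ hXm).1 hX]
    simp_rw [(hlaw _).map_eq]
  have hmapv : μ.map (fun ω => ∑' n, X n ω • u n) =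
      (Measure.infinitePi fun _ : ℕ => ν).map fun x => ∑' n, x n • u n := by
    rw [← hmap, AEMeasurable.map_map_of_aemeasurable (measurable_tsum_smul u).aemeasurable hXm]
    rfl
  have hvm : AEMeasurable (fun ω => ∑' n, X n ω • u n) μ :=
    (measurable_tsum_smul u).comp_aemeasurable hXm
  have hexact : IsExactMeasure (Polynomial.aeval T P) (μ.map fun ω => ∑' n, X n ω • u n) := by
    rw [hmapv]
    exact isExactMeasure_map_tsum_smul (hu.map_zero hT hP0) hu.map_succ hs
  have hpos : (μ.map fun ω => ∑' n, X n ω • u n).IsOpenPosMeasure := by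
    rw [hmapv]
    exact isOpenPosMeasure_map_tsum_smul (by rwa [hu.span_eq]) hs
  refine ⟨ae_of_ae_map hXm (hmap ▸ hs), hvm,
    ae_of_ae_map hvm hexact.ae_isFrequentlyHypercyclic, hexact, hpos⟩
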